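/- Let $K$ be a number field, let $k,b\in K^*$, and let $\phi(x)=k(x^2+b)/x$, viewed as a self-map of $\mathbb{P}^1(\overline K)$. Define $p_n,q_n\in K[x]$ by $p_0=x$, $q_0=1$ and $$p_n=k\,(p_{n-1}^2+b\,q_{n-1}^2),\qquad q_n=p_{n-1}q_{n-1}\qquad(n\ge 1),$$ so that $\phi^n=p_n/q_n$. Let $p_n^*$ be the polynomial $p_n$ obtained for $b=1$ and put $\delta_n=k\,p_n^*(1)$. Let $V_n=\phi^{-n}(0)$ and $K_n=K(V_n)$. Let $T_n=\bigcup_{0\le i\le n}V_i$ be the preimage tree of $0$ truncated at height $n$, rooted at $0$ and with edges given by $\phi$. Let $C_n$ be the centralizer, in the group $\mathrm{Aut}(T_n)$ of automorphisms of the rooted tree $T_n$, of the automorphism induced by $\iota(x)=-x$. Let $n\ge 3$, assume that $p_{n-1}$ is irreducible over $K$, and suppose that there is a (finite) prime $\mathfrak p$ of $K$, with normalized additive valuation $v_{\mathfrak p}$, such that $$v_{\mathfrak p}(\delta_n)\ \text{is odd (in particular } \delta_n\ne 0),\qquad v_{\mathfrak p}(\delta_j)=0\ \text{ for } 1\le j\le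 n-1,\qquad v_{\mathfrak p}(k)=v_{\mathfrak p}(b)=v_{\mathfrak p}(2)=0.$$ Then $K_{n-1}\subseteq K_n$ and $$[K_n:K_{n-1}]=2^{2^{n-2}}.$$ This is the maximum allowed by $C_n$: the kernel of the restriction map $C_n\to C_{n-1}$ has order $2^{2^{n-2}}$, and it equals the image of $\mathrm{Gal}(\overline K/K_{n-1})$ under its action on $T_n$. -/

import Mathlib

open Polynomial NumberField IsDedekindDomain

namespace ArborealQuadratic

section Polynomials

variable {K : Type*} [Field K]

/-- The dehomogenized pair `(p_n, q_n)` of the `n`-th iterate of the lift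
`(X, Y) ↦ (k (X² + b Y²), X Y)` of the map `φ(x) = k (x² + b) / x`;
thus `φⁿ = p_n / q_n`, `p_1 = k (x² + b)` and `q_1 = x`. -/
noncomputable def iterPair (k b : K) : ℕ → K[X] × K[X]
  | 0 => (X, 1)
  | n + 1 =>
    (C k * ((iterPair k b n).1 ^ 2 + C b * (iterPair k b n).2 ^ 2),
      (iterPair k b n).1 * (iterPair k b n).2)

/-- The numerator `p_n` of the `n`-th iterate of `φ(x) = k (x² + b) / x`. -/
noncomputable def numer (k b : K) (n : ℕ) : K[X] := (iterPair k b n).1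

/-- `δ_n = k · p_n^*(1)`, where `p_n^*` is the polynomial `p_n` for `b = 1`. -/
noncomputable def delta (k : K) (n : ℕ) : K := k * (numer k 1 n).eval 1

end Polynomials

/-- `HasOrd 𝔭 x m` says that `v_𝔭(x) = m` (so in particular `x ≠ 0`), for the normalized additive
valuation `v_𝔭` at the prime `𝔭` of `K`. Mathlib's valuation is multiplicative, `exp (-v_𝔭)`. -/
def HasOrd {K : Type*} [Field K] [NumberField K] (𝔭 : HeightOneSpectrum (𝓞 K)) (x : K) (m : ℤ) :
    Prop :=
  𝔭.valuation K x = WithZero.exp (-m)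

section Tree

variable {K : Type*} [Field K]

/-- The map `φ(x) = k (x² + b) / x` on the projective line over the algebraic closure of `K`;
for `k, b ≠ 0` it sends `0` and `∞` to `∞`. -/
noncomputable def phi (k b : K) : OnePoint (AlgebraicClosure K) → OnePoint (AlgebraicClosure K) :=
  open Classical in
  fun z => z.elim OnePoint.infty fun x =>
    if x = 0 then OnePoint.infty
    else ((algebraMap K (AlgebraicClosure K) k * (x ^ 2 + algebraMap K (AlgebraicClosure K) b) / x :
      AlgebraicClosure K) : OnePoint (AlgebraicClosure K))

/-- The vertices at height `n` of the preimage tree of `0`, i.e. `φ⁻ⁿ(0)`. -/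
def level (k b : K) (n : ℕ) : Set (OnePoint (AlgebraicClosure K)) :=
  {x | (phi k b)^[n] x = ((0 : AlgebraicClosure K) : OnePoint (AlgebraicClosure K))}

/-- The vertices of height at most `n` (including the root `0`) of the preimage tree of `0`. -/
def vertices (k b : K) (n : ℕ) : Set (OnePoint (AlgebraicClosure K)) :=
  {x | ∃ i ≤ n, x ∈ level k b i}

/-- The field `K_n = K(φ⁻ⁿ(0))`. -/
noncomputable def levelField (k b : K) (n : ℕ) : IntermediateField K (AlgebraicClosure K) :=
  IntermediateField.adjoin K
    {x | (x : OnePoint (AlgebraicClosure K)) ∈ level k b n}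

/-- The root `0` of the truncated tree `T_n`. -/
noncomputable def root (k b : K) (n : ℕ) : vertices k b n :=
  ⟨((0 : AlgebraicClosure K) : OnePoint (AlgebraicClosure K)), 0, Nat.zero_le n, rfl⟩

/-- The group `Aut(T_n)` of automorphisms of the rooted tree `T_n`: the permutations of the
vertices that fix the root and preserve the edges `x → φ(x)`. -/
def treeAut (k b : K) (n : ℕ) : Subgroup (Equiv.Perm (vertices k b n)) where
  carrier := {τ | τ (root k b n) = root k b n ∧
    ∀ x y : vertices k b n, phi k b x = y ↔ phi k b (τ x) = τ y}
  one_mem' := ⟨rfl, fun _ _ => Iff.rfl⟩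
  mul_mem' := by
    rintro σ τ ⟨hσ, hσ'⟩ ⟨hτ, hτ'⟩
    refine ⟨?_, fun x y => ?_⟩
    · rw [Equiv.Perm.mul_apply, hτ, hσ]
    · rw [hτ' x y, hσ' (τ x) (τ y)]
      rfl
  inv_mem' := by
    rintro σ ⟨hσ, hσ'⟩
    refine ⟨?_, fun x y => ?_⟩
    · rw [Equiv.Perm.inv_eq_iff_eq, hσ]
    · have h := hσ' (σ⁻¹ x) (σ⁻¹ y)
      simpa using h.symm

theorem map_mem_level {k b : K} {f : AlgebraicClosure K → AlgebraicClosure K} (h0 : f 0 = 0)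
    (hf : ∀ x, phi k b (OnePoint.map f x) = OnePoint.map f (phi k b x)) {i : ℕ}
    {x : OnePoint (AlgebraicClosure K)} (hx : x ∈ level k b i) :
    OnePoint.map f x ∈ level k b i := by
  have h : Function.Semiconj (OnePoint.map f) (phi k b) (phi k b) := fun x => (hf x).symm
  have h2 := (h.iterate_right i) x
  change (phi k b)^[i] _ = _
  rw [← h2, show (phi k b)^[i] x = _ from hx, OnePoint.map_some, h0]

theorem map_mem_vertices {k b : K} {f : AlgebraicClosure K → AlgebraicClosure K} (h0 : f 0 = 0)
    (hf : ∀ x, phi k b (OnePoint.map f x) = OnePoint.map f (phi k b x)) {n : ℕ}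
    {x : OnePoint (AlgebraicClosure K)} (hx : x ∈ vertices k b n) :
    OnePoint.map f x ∈ vertices k b n := by
  obtain ⟨i, hi, h⟩ := hx
  exact ⟨i, hi, map_mem_level h0 hf h⟩

theorem map_map_cancel {f g : AlgebraicClosure K → AlgebraicClosure K}
    (h : Function.LeftInverse g f) (x : OnePoint (AlgebraicClosure K)) :
    OnePoint.map g (OnePoint.map f x) = x := by
  induction x using OnePoint.rec with
  | infty => rfl
  | coe x => simp only [OnePoint.map_some, h x]

/-- The automorphism of `T_n` induced by a permutation of the algebraic closure that fixes `0` and,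
extended by `∞ ↦ ∞`, commutes with `φ`. -/
noncomputable def inducedAut (k b : K) (n : ℕ) (e : Equiv.Perm (AlgebraicClosure K)) (h0 : e 0 = 0)
    (he : ∀ x, phi k b (OnePoint.map e x) = OnePoint.map e (phi k b x)) : treeAut k b n :=
  have h0' : e.symm 0 = 0 := by rw [Equiv.symm_apply_eq, h0]
  have he' : ∀ x, phi k b (OnePoint.map e.symm x) = OnePoint.map e.symm (phi k b x) := by
    intro x
    have := he (OnePoint.map e.symm x)
    rw [map_map_cancel e.apply_symm_apply] at this
    rw [this, map_map_cancel e.symm_apply_apply]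
  ⟨{  toFun := fun x => ⟨OnePoint.map e x, map_mem_vertices h0 he x.2⟩
      invFun := fun x => ⟨OnePoint.map e.symm x, map_mem_vertices h0' he' x.2⟩
      left_inv := fun x => Subtype.ext (map_map_cancel e.left_inv _)
      right_inv := fun x => Subtype.ext (map_map_cancel e.right_inv _) },
    Subtype.ext (by
      change OnePoint.map e ((0 : AlgebraicClosure K) : OnePoint (AlgebraicClosure K)) = _
      rw [OnePoint.map_some, h0]
      rfl),
    fun x y => by
      change phi k b x = y ↔ phi k b (OnePoint.map e x) = OnePoint.map e y
      rw [he]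
      refine ⟨fun h => by rw [h], fun h => ?_⟩
      rw [← map_map_cancel e.symm_apply_apply (phi k b x), h, map_map_cancel e.symm_apply_apply]⟩

theorem phi_neg (k b : K) (x : OnePoint (AlgebraicClosure K)) :
    phi k b (OnePoint.map (Equiv.neg (AlgebraicClosure K)) x) =
      OnePoint.map (Equiv.neg (AlgebraicClosure K)) (phi k b x) := by
  induction x using OnePoint.rec with
  | infty => rfl
  | coe x =>
    rw [OnePoint.map_some]
    by_cases hx : x = 0
    · simp [phi, hx]
    · simp [phi, hx, div_neg]

theorem phi_gal (k b : K) (σ : AlgebraicClosure K ≃ₐ[K] AlgebraicClosure K)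
    (x : OnePoint (AlgebraicClosure K)) :
    phi k b (OnePoint.map σ.toEquiv x) = OnePoint.map σ.toEquiv (phi k b x) := by
  induction x using OnePoint.rec with
  | infty => rfl
  | coe x =>
    rw [OnePoint.map_some]
    by_cases hx : x = 0
    · simp [phi, hx]
    · simp [phi, hx]

/-- The automorphism of `T_n` induced by `ι(x) = -x`. -/
noncomputable def iota (k b : K) (n : ℕ) : treeAut k b n :=
  inducedAut k b n (Equiv.neg _) neg_zero (phi_neg k b)

/-- The centralizer `C_n` of `ι` in `Aut(T_n)`. -/
def centralizerIota (k b : K) (n : ℕ) : Subgroup (treeAut k b n) :=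
  Subgroup.centralizer {iota k b n}

/-- The kernel of the restriction map `C_n → C_m` for `m ≤ n`: the elements of `C_n` that fix
all vertices of height at most `m`. -/
def centralizerKer (k b : K) (n m : ℕ) : Subgroup (treeAut k b n) :=
  centralizerIota k b n ⊓
    fixingSubgroup (treeAut k b n) {x : vertices k b n | (x : OnePoint _) ∈ vertices k b m}

/-- The action of the absolute Galois group of `K` on `T_n`. -/
noncomputable def galAction (k b : K) (n : ℕ) :
    (AlgebraicClosure K ≃ₐ[K] AlgebraicClosure K) →* treeAut k b n where
  toFun σ := inducedAut k b n σ.toEquiv (map_zero σ) (phi_gal k b σ)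
  map_one' := by
    refine Subtype.ext (Equiv.ext fun x => Subtype.ext ?_)
    change OnePoint.map (id : AlgebraicClosure K → AlgebraicClosure K) x = x
    rw [OnePoint.map_id]
    rfl
  map_mul' σ τ := by
    refine Subtype.ext (Equiv.ext fun x => Subtype.ext ?_)
    change OnePoint.map (σ ∘ τ) (x : OnePoint (AlgebraicClosure K)) =
      OnePoint.map σ (OnePoint.map τ (x : OnePoint (AlgebraicClosure K)))
    rw [OnePoint.map_comp]
    rfl

end Tree

end ArborealQuadratic

/-! Since φ(x) = α means k x² - α x + k b = 0, the field K_n is generated over K_{n-1} by square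
roots of the discriminants α² - 4k²b, with α running over the roots of p_{n-1}. These roots come in
pairs ±α, so there are 2^{n-2} discriminants, and everything reduces to their independence modulo
squares in K_{n-1} (`not_isSquare_prod_discr`).

Here 4k²b is the square of the critical values φ(±√b) = ±2k√b, so the product of α² - 4k²b over all
roots is, up to 𝔭-units, the square of p_n^*(1) (`prod_discr`). Two distinct roots of p_{n-1}
congruent modulo a prime above 𝔭 would make some point of their orbits congruent to a critical
point, forcing v(δ_j) > 0 for some j < n. Hence the roots stay distinct
(`eq_of_iterVal_of_map_sub_lt_one`), 𝔭 is unramified in K_{n-1}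
(`valuation_algebraMap_of_generators`), and a single discriminant carries the odd valuation v(δ_n)
while the others are units (`exists_valuation_discr`). Galois permutes the discriminants
transitively, so any nonempty product has a conjugate of odd valuation and is not a square.

Kummer theory then realizes every choice of signs (`signSubmodule_eq_top`). On the tree, an element
of the kernel of C_n → C_{n-1} can only swap x with b/x, and commuting with ι ties the swaps above α
to those above -α; it is therefore a set of discriminants (`eq_of_movedDiscr_eq`). Galois realizes
all these sets, which yields the order of the kernel, its equality with the image, and the degree
(`relfinrank_levelField`). -/

namespace ArborealQuadratic

/-! ### Values of the iterates over an arbitrary commutative ring -/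

section Recursion

/-- The pair `(p_n(x), q_n(x))` of values of the iterated pair at a point of a commutative ring. -/
def iterVal {R : Type*} [CommRing R] (k b x : R) : ℕ → R × R
  | 0 => (x, 1)
  | n + 1 =>
    (k * ((iterVal k b x n).1 ^ 2 + b * (iterVal k b x n).2 ^ 2),
      (iterVal k b x n).1 * (iterVal k b x n).2)

theorem iterVal_map {R S : Type*} [CommRing R] [CommRing S] (f : R →+* S) (k b x : R) (n : ℕ) :
    iterVal (f k) (f b) (f x) n = (f (iterVal k b x n).1, f (iterVal k b x n).2) := by
  induction n with
  | zero => simp [iterVal]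
  | succ n ih => simp [iterVal, ih]

theorem aeval_iterPair {K A : Type*} [Field K] [CommRing A] [Algebra K A] (k b : K) (x : A)
    (n : ℕ) :
    (aeval x (iterPair k b n).1, aeval x (iterPair k b n).2) =
      iterVal (algebraMap K A k) (algebraMap K A b) x n := by
  induction n with
  | zero => simp [iterVal, iterPair]
  | succ n ih => simp [iterVal, iterPair, ← ih]

theorem aeval_numer {K A : Type*} [Field K] [CommRing A] [Algebra K A] (k b : K) (x : A) (n : ℕ) :
    aeval x (numer k b n) = (iterVal (algebraMap K A k) (algebraMap K A b) x n).1 := by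
  rw [← aeval_iterPair]; rfl

theorem algebraMap_delta {K A : Type*} [Field K] [CommRing A] [Algebra K A] (k : K) (n : ℕ) :
    algebraMap K A (delta k n) =
      algebraMap K A k * (iterVal (algebraMap K A k) 1 1 n).1 := by
  have h := aeval_numer k 1 (1 : A) n
  rw [map_one] at h
  rw [delta, map_mul, ← h, ← map_one (algebraMap K A), aeval_algebraMap_apply,
    coe_aeval_eq_eval]

variable {R : Type*} [CommRing R] (k b : R)

/-- Scaling by s conjugates φ for b = 1 to φ for b = s². The factor s is kept beside `q_n` because
`q_n` has weight 2^n - 1. -/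
theorem iterVal_critical {s : R} (hs : s ^ 2 = b) (n : ℕ) :
    (iterVal k b s n).1 = s ^ 2 ^ n * (iterVal k 1 1 n).1 ∧
      s * (iterVal k b s n).2 = s ^ 2 ^ n * (iterVal k 1 1 n).2 := by
  induction n with
  | zero => simp [iterVal]
  | succ n ih =>
    obtain ⟨h1, h2⟩ := ih
    have h3 : b * (iterVal k b s n).2 ^ 2 = (s ^ 2 ^ n * (iterVal k 1 1 n).2) ^ 2 := by
      rw [← h2, ← hs]; ring
    constructor
    · simp only [iterVal]
      rw [h3, h1, pow_succ 2 n, pow_mul]; ring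
    · simp only [iterVal]
      rw [mul_left_comm, h2, h1, pow_succ 2 n, pow_mul]; ring

theorem iterVal_neg (x : R) (n : ℕ) :
    iterVal k b (-x) (n + 1) = ((iterVal k b x (n + 1)).1, -(iterVal k b x (n + 1)).2) := by
  induction n with
  | zero => simp [iterVal]
  | succ n ih =>
    rw [iterVal, ih]
    exact Prod.ext (by rw [neg_sq]; rfl) (mul_neg _ _)


end Recursion

/-! ### Roots of p_n as backward orbits of 0 -/

section Field

variable {F : Type*} [Field F] {k b : F}

theorem iterVal_zero_ne_zero (hk : k ≠ 0) (hb : b ≠ 0) (n : ℕ) :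
    (iterVal k b 0 (n + 1)).2 = 0 ∧ (iterVal k b 0 (n + 1)).1 ≠ 0 := by
  induction n with
  | zero => simp [iterVal, hk, hb]
  | succ n ih => rw [iterVal]; simp [hk, ih]

theorem ne_zero_of_iterVal (hk : k ≠ 0) (hb : b ≠ 0) {x : F} {n : ℕ}
    (h : (iterVal k b x (n + 1)).1 = 0) : x ≠ 0 := by
  rintro rfl
  exact (iterVal_zero_ne_zero hk hb n).2 h

/-- The definition applies φ last; here it is applied first. The power of x comes from homogeneity
of degree 2^n, since (k(x² + b), x) = x · (φ(x), 1). -/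
theorem iterVal_succ {x : F} (hx : x ≠ 0) (n : ℕ) :
    (iterVal k b x (n + 1)).1 = x ^ 2 ^ n * (iterVal k b (k * (x ^ 2 + b) / x) n).1 ∧
      (iterVal k b x (n + 1)).2 = x ^ 2 ^ n * (iterVal k b (k * (x ^ 2 + b) / x) n).2 := by
  induction n with
  | zero => simp [iterVal, mul_div_cancel₀ _ hx]
  | succ n ih =>
    rw [iterVal, ih.1, ih.2, iterVal, pow_succ 2 n, pow_mul]
    constructor <;> ring

theorem iterVal_succ_eq_zero_iff {x : F} (hx : x ≠ 0) (n : ℕ) :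
    (iterVal k b x (n + 1)).1 = 0 ↔ (iterVal k b (k * (x ^ 2 + b) / x) n).1 = 0 := by
  simp [(iterVal_succ (k := k) (b := b) hx n).1, hx]

end Field

/-! ### Reduction of the roots at a prime of good reduction -/

section Valuation

variable {F Γ : Type*} [Field F] [LinearOrderedCommGroupWithZero Γ] {v : Valuation F Γ} {k b : F}

theorem map_eq_one_of_iterVal (hk : v k = 1) (hb : v b = 1) {x : F} {n : ℕ}
    (h : (iterVal k b x (n + 1)).1 = 0) : v x = 1 := by
  have hk0 : k ≠ 0 := by rintro rfl; simp at hk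
  have hb0 : b ≠ 0 := by rintro rfl; simp at hb
  -- At height 0 the only root is x = 0, which is integral but not a unit, so the induction carries
  -- integrality separately.
  suffices H : ∀ n (x : F), (iterVal k b x n).1 = 0 →
      v x ≤ 1 ∧ (0 < n → v x = 1) from (H _ x h).2 n.succ_pos
  intro n
  induction n with
  | zero => intro x hx; simp_all [iterVal]
  | succ n ih =>
    intro x hx
    have hx0 := ne_zero_of_iterVal hk0 hb0 hx
    have hg := (ih _ ((iterVal_succ_eq_zero_iff hx0 n).1 hx)).1
    set g := k * (x ^ 2 + b) / x with hg'
    -- With g = φ(x), the second factor is k times the other preimage b/x. If x had a pole, both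
    -- factors would have the same valuation, exceeding 1, although their product is a unit.
    have e : x * (g - k * x) = k * b := by rw [hg']; field_simp; ring
    have e' : v x * v (g - k * x) = 1 := by rw [← map_mul, e, map_mul, hk, hb, one_mul]
    have hle : v x ≤ 1 := by
      by_contra! hlt
      have : v (g - k * x) = v x := by
        rw [Valuation.map_sub_eq_of_lt_right] <;> rw [map_mul, hk, one_mul]
        exact hg.trans_lt hlt
      rw [this] at e'
      exact (one_lt_mul'' hlt hlt).ne' e' 
    have hle' : v (g - k * x) ≤ 1 := (v.map_sub _ _).trans (by simp [hk, hg, hle])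
    have : v x = 1 := eq_one_of_one_le_mul_left hle hle' e'.ge
    exact ⟨hle, fun _ => this⟩

/-- If x² ≡ b, then x reduces to a critical point, where `iterVal_critical` applies over the residue
field: a unit times p_{n+1}^*(1) reduces to p_{n+1}(x) = 0. -/
theorem map_iterVal_one_lt_one (hk : v k = 1) (hb : v b = 1) {x : F} {n : ℕ}
    (h : (iterVal k b x (n + 1)).1 = 0) (hx : v (x ^ 2 - b) < 1) :
    v (iterVal k 1 1 (n + 1)).1 < 1 := by
  have hv := map_eq_one_of_iterVal hk hb h
  let O := v.valuationSubring
  have key : ∀ y : O, IsLocalRing.residue O y = 0 ↔ v y < 1 := fun y => by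
    rw [IsLocalRing.residue_eq_zero_iff, ValuationSubring.valuation_lt_one_iff,
      ← (v.isEquiv_valuation_valuationSubring).lt_one_iff_lt_one]
  let k' : O := ⟨k, hk.le⟩
  let b' : O := ⟨b, hb.le⟩
  let x' : O := ⟨x, hv.le⟩
  have h1 : (iterVal k' b' x' (n + 1)).1 = 0 := by
    have := congrArg Prod.fst (iterVal_map O.subtype k' b' x' (n + 1))
    exact Subtype.ext (this.symm.trans h)
  have h2 : IsLocalRing.residue O x' ^ 2 = IsLocalRing.residue O b' := by
    rw [← sub_eq_zero, ← map_pow, ← map_sub, key]; exact hx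
  have h3 := (iterVal_critical (IsLocalRing.residue O k') _ h2 (n + 1)).1
  have h4 : IsLocalRing.residue O x' ≠ 0 := by rw [Ne, key]; exact hv.not_lt
  rw [iterVal_map, h1, map_zero, zero_eq_mul, or_iff_right (pow_ne_zero _ h4),
    ← map_one (IsLocalRing.residue O), iterVal_map, key] at h3
  have h5 := congrArg Prod.fst (iterVal_map O.subtype k' 1 1 (n + 1))
  rw [map_one] at h5
  change (iterVal k 1 1 (n + 1)).1 = _ at h5
  rw [h5]; exact h3

/-- If x ≡ y, then φ(x) ≡ φ(y), so φ(x) = φ(y) by induction. If x ≠ y, they are the two preimages of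
one point, so xy = b and x² - b = x(x - y) ≡ 0, against `map_iterVal_one_lt_one`. -/
theorem eq_of_iterVal_of_map_sub_lt_one (hk : v k = 1) (hb : v b = 1) {n : ℕ}
    (hd : ∀ j, 1 ≤ j → j ≤ n → v (iterVal k 1 1 j).1 = 1) {x y : F}
    (hx : (iterVal k b x n).1 = 0) (hy : (iterVal k b y n).1 = 0) (hxy : v (x - y) < 1) :
    x = y := by
  have hk0 : k ≠ 0 := by rintro rfl; simp at hk
  have hb0 : b ≠ 0 := by rintro rfl; simp at hb
  induction n generalizing x y with
  | zero => simp_all [iterVal]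
  | succ n ih =>
    have hx0 := ne_zero_of_iterVal hk0 hb0 hx
    have hy0 := ne_zero_of_iterVal hk0 hb0 hy
    have hvx := map_eq_one_of_iterVal hk hb hx
    have hvy := map_eq_one_of_iterVal hk hb hy
    have e : k * (x ^ 2 + b) / x - k * (y ^ 2 + b) / y = k * (x - y) * (x * y - b) / (x * y) := by
      field_simp; ring
    have hle : v (x * y - b) ≤ 1 := (v.map_sub _ _).trans (by simp [hvx, hvy, hb])
    have hφ := ih (fun j h1 h2 => hd j h1 (h2.trans n.le_succ))
      ((iterVal_succ_eq_zero_iff hx0 n).1 hx) ((iterVal_succ_eq_zero_iff hy0 n).1 hy) (by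
        rw [e]; simp only [map_mul, map_div₀, hk, hvx, hvy, one_mul, div_one]
        exact mul_lt_one_of_nonneg_of_lt_one_left zero_le hxy hle)
    by_contra hne
    rw [← sub_eq_zero, e] at hφ
    have hb' : x * y = b := by
      have := sub_ne_zero.2 hne
      simpa [hk0, hx0, hy0, this, sub_eq_zero] using hφ
    refine (map_iterVal_one_lt_one hk hb hx ?_).ne (hd _ n.succ_pos le_rfl)
    rw [show x ^ 2 - b = x * (x - y) by rw [← hb']; ring, map_mul, hvx, one_mul]
    exact hxy

end Valuation

/-! ### Inertia and unramified primes -/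

theorem mem_fixingSubgroup_adjoin {K Ω : Type*} [Field K] [Field Ω] [Algebra K Ω] {S : Set Ω}
    {σ : Gal(Ω/K)} (h : ∀ x ∈ S, σ x = x) : σ ∈ (IntermediateField.adjoin K S).fixingSubgroup := by
  have : IntermediateField.adjoin K S ≤
      IntermediateField.fixedField (Subgroup.zpowers σ) := by
    rw [IntermediateField.adjoin_le_iff]
    rintro x hx ⟨_, n, rfl⟩
    exact zpow_mem (show σ ∈ MulAction.stabilizer Gal(Ω/K) x from h x hx) n
  rw [IntermediateField.mem_fixingSubgroup_iff]
  exact fun x hx => this hx ⟨σ, Subgroup.mem_zpowers σ⟩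

theorem exists_heightOneSpectrum_liesOver {K : Type*} (L : Type*) [Field K] [Field L]
    [Algebra K L] [Algebra.IsAlgebraic K L] (𝔭 : HeightOneSpectrum (𝓞 K)) :
    ∃ 𝔓 : HeightOneSpectrum (𝓞 L), 𝔓.asIdeal.LiesOver 𝔭.asIdeal := by
  obtain ⟨⟨P, hP, hl⟩⟩ := 𝔭.asIdeal.nonempty_primesOver (S := 𝓞 L)
  exact ⟨⟨P, hP, Ideal.ne_bot_of_liesOver_of_ne_bot 𝔭.ne_bot P⟩, hl⟩

/-- Inertia is defined by its action on algebraic integers; a 𝔓-integral x is a quotient a/d with d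
prime to 𝔓, and the congruence passes to it. -/
theorem valuation_sub_lt_one_of_mem_inertia {K L : Type*} [Field K] [Field L]
    [NumberField L] [Algebra K L] (𝔓 : HeightOneSpectrum (𝓞 L)) {σ : Gal(L/K)}
    (hσ : σ ∈ 𝔓.asIdeal.inertia Gal(L/K)) {x : L} (hx : 𝔓.valuation L x ≤ 1) :
    𝔓.valuation L (σ x - x) < 1 := by
  obtain ⟨a, ⟨d, hd⟩, h⟩ := 𝔓.exists_primeCompl_mul_eq_of_integer x hx
  have hσ' : ∀ y : 𝓞 L, 𝔓.valuation L (σ y - y) < 1 := fun y => by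
    have := (𝔓.valuation_lt_one_iff_mem (K := L) _).2 (hσ y)
    exact this
  have hd1 : 𝔓.valuation L d = 1 := (𝔓.valuation_eq_one_iff_notMem (K := L)).2 hd
  have hσd : 𝔓.valuation L (σ d) = 1 := by
    have := Valuation.map_add_eq_of_lt_left (𝔓.valuation L) ((hσ' d).trans_eq hd1.symm)
    rwa [add_sub_cancel, hd1] at this
  have e : (σ x - x) * σ d = (σ a - a) - x * (σ d - d) := by
    have h' : σ x * σ d = σ a := by rw [← map_mul]; exact congrArg σ h
    have h'' : x * (d : L) = a := h
    linear_combination h' - h''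
  have : 𝔓.valuation L (σ x - x) = 𝔓.valuation L ((σ x - x) * σ d) := by
    rw [map_mul, hσd, mul_one]
  rw [this, e]
  refine Valuation.map_sub_lt _ (hσ' a) ?_
  rw [map_mul]
  exact mul_lt_one_of_nonneg_of_lt_one_right hx zero_le (hσ' d)

variable {K L : Type*} [Field K] [NumberField K] [Field L] [NumberField L] [Algebra K L]

theorem valuation_algebraMap_of_inertia_eq_bot [IsGalois K L] (𝔭 : HeightOneSpectrum (𝓞 K))
    (𝔓 : HeightOneSpectrum (𝓞 L)) [𝔓.asIdeal.LiesOver 𝔭.asIdeal]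
    (h : 𝔓.asIdeal.inertia Gal(L/K) = ⊥) (x : K) :
    𝔓.valuation L (algebraMap K L x) = 𝔭.valuation K x := by
  have : 𝔭.asIdeal.IsMaximal := 𝔭.isMaximal
  have : Finite (𝓞 K ⧸ 𝔭.asIdeal) := Ring.HasFiniteQuotients.finiteQuotient 𝔭.ne_bot
  have e : 𝔓.asIdeal.ramificationIdx (𝓞 K) = 1 := by
    rw [← Ideal.ramificationIdxIn_eq_ramificationIdx 𝔭.asIdeal 𝔓.asIdeal Gal(L/K),
      ← Ideal.card_inertia_eq_ramificationIdxIn (G := Gal(L/K)) 𝔭.asIdeal 𝔓.asIdeal, h]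
    simp
  rw [← HeightOneSpectrum.valuation_liesOver L 𝔭 𝔓,
    Ideal.ramificationIdx'_eq_ramificationIdx _ _ 𝔭.ne_bot, e, pow_one]

/-- Inertia moves no 𝔓-integral generator modulo 𝔓, so if congruent conjugates are equal it fixes
the generators and is trivial: the ramification index is 1. -/
theorem valuation_algebraMap_of_generators [IsGalois K L] (𝔭 : HeightOneSpectrum (𝓞 K))
    (𝔓 : HeightOneSpectrum (𝓞 L)) [𝔓.asIdeal.LiesOver 𝔭.asIdeal] {S : Set L}
    (hS : IntermediateField.adjoin K S = ⊤) (h1 : ∀ x ∈ S, 𝔓.valuation L x ≤ 1)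
    (h2 : ∀ x ∈ S, ∀ σ : Gal(L/K), 𝔓.valuation L (σ x - x) < 1 → σ x = x) (x : K) :
    𝔓.valuation L (algebraMap K L x) = 𝔭.valuation K x := by
  refine valuation_algebraMap_of_inertia_eq_bot 𝔭 𝔓 ((Subgroup.eq_bot_iff_forall _).2 ?_) x
  intro σ hσ
  have h := mem_fixingSubgroup_adjoin fun x hx =>
    h2 x hx σ (valuation_sub_lt_one_of_mem_inertia 𝔓 hσ (h1 x hx))
  rw [hS, IntermediateField.mem_fixingSubgroup_iff] at h
  exact AlgEquiv.ext fun y => h y IntermediateField.mem_top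

/-! ### Degree and leading coefficient of p_n -/

section Degree

variable {K : Type*} [Field K] (k b : K)

theorem natDegree_iterPair_le (n : ℕ) :
    (iterPair k b n).1.natDegree ≤ 2 ^ n ∧ (iterPair k b n).2.natDegree < 2 ^ n := by
  induction n with
  | zero => simp [iterPair]
  | succ n ih =>
    obtain ⟨hp, hq⟩ := ih
    simp only [iterPair]
    constructor
    · compute_degree
      omega
    · have := natDegree_mul_le (p := (iterPair k b n).1) (q := (iterPair k b n).2)
      omega

/-- Multiplying by k makes the recursion for the top coefficient a pure squaring. -/
theorem mul_coeff_numer (n : ℕ) : k * (numer k b n).coeff (2 ^ n) = k ^ 2 ^ n := by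
  induction n with
  | zero => simp [numer, iterPair]
  | succ n ih =>
    obtain ⟨hp, hq⟩ := natDegree_iterPair_le k b n
    have h0 : (C b * (iterPair k b n).2 ^ 2).coeff (2 ^ (n + 1)) = 0 := by
      refine coeff_eq_zero_of_natDegree_lt (lt_of_le_of_lt (b := 2 * (iterPair k b n).2.natDegree) ?_ ?_)
      · compute_degree
      · omega
    have h1 : ((iterPair k b n).1 ^ 2).coeff (2 ^ (n + 1)) = ((iterPair k b n).1.coeff (2 ^ n)) ^ 2 := by
      rw [pow_succ 2 n, mul_comm, coeff_pow_of_natDegree_le hp]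
    simp only [numer, iterPair, coeff_C_mul, coeff_add, h0, h1, add_zero] at ih ⊢
    rw [pow_succ 2 n, pow_mul, ← ih]; ring

theorem natDegree_numer {k : K} (hk : k ≠ 0) (n : ℕ) : (numer k b n).natDegree = 2 ^ n := by
  refine natDegree_eq_of_le_of_coeff_ne_zero (natDegree_iterPair_le k b n).1 fun h => ?_
  have := mul_coeff_numer k b n
  rw [h, mul_zero] at this
  exact pow_ne_zero _ hk this.symm

theorem mul_leadingCoeff_numer {k : K} (hk : k ≠ 0) (n : ℕ) :
    k * (numer k b n).leadingCoeff = k ^ 2 ^ n := by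
  rw [leadingCoeff, natDegree_numer b hk, mul_coeff_numer]

end Degree

/-! ### Roots of p_n and the product of the discriminants -/

section Roots

variable {K L : Type*} [Field K] [Field L] [Algebra K L] {k b : K}

open scoped Classical in
/-- The set of roots of `p_n` in an extension field. -/
noncomputable def rootFinset (L : Type*) [Field L] [Algebra K L] (k b : K) (n : ℕ) : Finset L :=
  ((numer k b n).aroots L).toFinset

theorem numer_ne_zero (hk : k ≠ 0) (n : ℕ) : numer k b n ≠ 0 :=
  fun h => pow_ne_zero (2 ^ n) hk (by rw [← mul_leadingCoeff_numer b hk, h]; simp)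

theorem mem_rootFinset (hk : k ≠ 0) {n : ℕ} {x : L} :
    x ∈ rootFinset L k b n ↔ (iterVal (algebraMap K L k) (algebraMap K L b) x n).1 = 0 := by
  classical
  rw [rootFinset, Multiset.mem_toFinset, mem_aroots, aeval_numer]
  simp [numer_ne_zero hk]

theorem neg_mem_rootFinset (hk : k ≠ 0) {n : ℕ} {x : L} (hx : x ∈ rootFinset L k b (n + 1)) :
    -x ∈ rootFinset L k b (n + 1) := by
  rw [mem_rootFinset hk] at *
  rwa [iterVal_neg]

theorem map_mem_rootFinset (hk : k ≠ 0) {n : ℕ} {x : L} (σ : Gal(L/K))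
    (hx : x ∈ rootFinset L k b n) : σ x ∈ rootFinset L k b n := by
  rw [mem_rootFinset hk] at *
  have h := iterVal_map (σ : L →+* L) (algebraMap K L k) (algebraMap K L b) x n
  simp only [RingHom.coe_coe, AlgEquiv.commutes] at h
  rw [h, hx, map_zero]

theorem aeval_numer_eq_prod {n : ℕ} (hsep : (numer k b n).Separable)
    (hsplit : ((numer k b n).map (algebraMap K L)).Splits)
    (Ω : Type*) [Field Ω] [Algebra K Ω] [Algebra L Ω] [IsScalarTower K L Ω] (x : Ω) :
    aeval x (numer k b n) = algebraMap K Ω (numer k b n).leadingCoeff *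
      ∏ α ∈ rootFinset L k b n, (x - algebraMap L Ω α) := by
  classical
  have h0 : numer k b n ≠ 0 := hsep.ne_zero
  have h := congrArg (aeval x) hsplit.eq_prod_roots
  rw [aeval_map_algebraMap, map_mul, aeval_C, leadingCoeff_map, ← IsScalarTower.algebraMap_apply,
    map_multiset_prod] at h
  rw [h, rootFinset, Finset.prod, Multiset.toFinset_val,
    (nodup_aroots_iff_of_splits h0 hsplit |>.2 hsep).dedup]
  simp [Multiset.map_map, aroots]

theorem card_rootFinset (hk : k ≠ 0) {n : ℕ} (hsep : (numer k b n).Separable)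
    (hsplit : ((numer k b n).map (algebraMap K L)).Splits) :
    (rootFinset L k b n).card = 2 ^ n := by
  classical
  have h2 := nodup_aroots_iff_of_splits (numer_ne_zero hk n) hsplit |>.2 hsep
  rw [rootFinset, Multiset.toFinset_card_of_nodup h2, ← natDegree_numer b hk, aroots,
    ← hsplit.natDegree_eq_card_roots, natDegree_map]

/-- Evaluate p_{n+1} at the critical value x = φ(s) = 2ks, where s² = b. As p_{n+1} is even,
p_{n+1}(x)² = p_{n+1}(x) p_{n+1}(-x), and factoring both gives the product of α² - x²; the value
p_{n+1}(x) itself comes from `iterVal_critical`. -/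
theorem prod_discr (hb : b ≠ 0) {n : ℕ} (hsep : (numer k b (n + 1)).Separable)
    (hsplit : ((numer k b (n + 1)).map (algebraMap K L)).Splits) :
    algebraMap K L (numer k b (n + 1)).leadingCoeff ^ 2 * 
      ∏ α ∈ rootFinset L k b (n + 1), (α ^ 2 - algebraMap K L (4 * k ^ 2 * b)) =
    (algebraMap K L b ^ 2 ^ n * (iterVal (algebraMap K L k) 1 1 (n + 2)).1) ^ 2 := by
  let Ω := AlgebraicClosure L
  obtain ⟨s, hs⟩ := IsAlgClosed.exists_pow_nat_eq (algebraMap K Ω b) two_pos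
  have hb0 : algebraMap K Ω b ≠ 0 := by simpa using hb
  have hs0 : s ≠ 0 := by rintro rfl; simp at hs; exact hb0 hs.symm
  set kΩ := algebraMap K Ω k with hkΩ
  set x : Ω := kΩ * (s ^ 2 + algebraMap K Ω b) / s with hx
  have hx2 : x ^ 2 = algebraMap K Ω (4 * k ^ 2 * b) := by
    have : x = 2 * kΩ * s := by rw [hx, ← hs, div_eq_iff hs0]; ring
    rw [this]; simp only [map_mul, map_pow, map_ofNat, ← hs]; ring
  have h1 := (iterVal_succ (k := kΩ) (b := algebraMap K Ω b) hs0 (n + 1)).1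
  rw [(iterVal_critical kΩ _ hs (n + 1 + 1)).1, ← hx, pow_succ 2 (n + 1), pow_mul, sq, mul_assoc,
    mul_right_inj' (pow_ne_zero _ hs0), pow_succ' 2 n, pow_mul, hs] at h1
  have h2 : aeval x (numer k b (n + 1)) = aeval (-x) (numer k b (n + 1)) := by
    rw [aeval_numer, aeval_numer, iterVal_neg]
  rw [← aeval_numer] at h1
  apply FaithfulSMul.algebraMap_injective L Ω
  have h3 := congrArg Prod.fst (iterVal_map (algebraMap L Ω) (algebraMap K L k) 1 1 (n + 2))
  simp only [map_one, ← IsScalarTower.algebraMap_apply] at h3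
  simp only [map_mul, map_pow, map_prod, map_sub, ← IsScalarTower.algebraMap_apply, ← h3]
  rw [h1, sq (aeval x _)]
  nth_rw 2 [h2]
  rw [aeval_numer_eq_prod hsep hsplit Ω x, aeval_numer_eq_prod hsep hsplit Ω (-x),
    mul_mul_mul_comm, ← sq, ← Finset.prod_mul_distrib]
  congr 1
  have h4 : 4 * algebraMap K Ω k ^ 2 * algebraMap K Ω b = x ^ 2 := by
    rw [hx2]; simp only [map_mul, map_pow, map_ofNat]
  simp only [map_ofNat, h4]
  exact Finset.prod_congr rfl fun _ _ => by ring

end Roots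

/-! ### Independence of the discriminants modulo squares -/

section Independence

/-- The discriminants `α² - 4 k² b` of the quadratic polynomials `k (x² + b) - α x`, where `α`
runs over the roots of `p_n`. -/
noncomputable def discrFinset {K : Type*} (L : Type*) [Field K] [Field L] [Algebra K L] (k b : K)
    (n : ℕ) : Finset L :=
  open scoped Classical in
  (rootFinset L k b n).image fun α => α ^ 2 - algebraMap K L (4 * k ^ 2 * b)

theorem mem_discrFinset {K L : Type*} [Field K] [Field L] [Algebra K L] {k b : K} {n : ℕ} {d : L} :
    d ∈ discrFinset L k b n ↔
      ∃ α ∈ rootFinset L k b n, α ^ 2 - algebraMap K L (4 * k ^ 2 * b) = d := by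
  classical
  rw [discrFinset]; convert Finset.mem_image

theorem card_discrFinset {K L : Type*} [Field K] [Field L] [Algebra K L] [CharZero K] {k b : K}
    (hk : k ≠ 0) (hb : b ≠ 0) {n : ℕ} (hsep : (numer k b (n + 1)).Separable)
    (hsplit : ((numer k b (n + 1)).map (algebraMap K L)).Splits) :
    (discrFinset L k b (n + 1)).card = 2 ^ n := by
  classical
  have : CharZero L := charZero_of_injective_algebraMap (algebraMap K L).injective
  have h := card_rootFinset hk hsep hsplit
  have h2 := Finset.card_eq_sum_card_fiberwise (s := rootFinset L k b (n + 1))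
    (t := discrFinset L k b (n + 1)) (f := fun α => α ^ 2 - algebraMap K L (4 * k ^ 2 * b))
    fun α hα => mem_discrFinset.2 ⟨α, hα, rfl⟩
  rw [Finset.sum_const_nat (m := 2), h, pow_succ, mul_left_inj' two_ne_zero] at h2
  · exact h2.symm
  -- Each fibre of α ↦ α² - 4k²b is {α, -α}, with two elements because α ≠ 0.
  intro d hd
  obtain ⟨α, hα, rfl⟩ := mem_discrFinset.1 hd
  have hα0 : α ≠ 0 := ne_zero_of_iterVal (by simpa) (by simpa) ((mem_rootFinset hk).1 hα)
  rw [Finset.card_eq_two]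
  refine ⟨α, -α, self_ne_neg.2 hα0, ?_⟩
  ext β
  simp only [Finset.mem_filter, sub_left_inj, sq_eq_sq_iff_eq_or_eq_neg, Finset.mem_insert,
    Finset.mem_singleton]
  refine ⟨fun h => h.2, fun h => ⟨?_, h⟩⟩
  rcases h with rfl | rfl
  exacts [hα, neg_mem_rootFinset hk hα]

open WithZero in
/-- Exactly one discriminant has nonzero, and then odd, valuation. -/
theorem exists_valuation_discr {K L : Type*} [Field K] [Field L] [Algebra K L] [CharZero K]
    {k b : K} (v : Valuation L ℤᵐ⁰) {n : ℕ}
    (hk : v (algebraMap K L k) = 1) (hb : v (algebraMap K L b) = 1)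
    (hd : ∀ j, 1 ≤ j → j ≤ n + 1 → v (iterVal (algebraMap K L k) 1 1 j).1 = 1) {m : ℤ} (hm : m ≠ 0)
    (hdn : v (iterVal (algebraMap K L k) 1 1 (n + 2)).1 = exp m)
    (hsep : (numer k b (n + 1)).Separable)
    (hsplit : ((numer k b (n + 1)).map (algebraMap K L)).Splits) :
    ∃ β ∈ rootFinset L k b (n + 1),
      v (β ^ 2 - algebraMap K L (4 * k ^ 2 * b)) = exp m ∧
      ∀ γ ∈ rootFinset L k b (n + 1), γ ^ 2 ≠ β ^ 2 →
        v (γ ^ 2 - algebraMap K L (4 * k ^ 2 * b)) = 1 := by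
  classical
  have : CharZero L := charZero_of_injective_algebraMap (algebraMap K L).injective
  have hk0 : k ≠ 0 := by rintro rfl; simp at hk
  have hb0 : b ≠ 0 := by rintro rfl; simp at hb
  have h4 : v (4 : L) ≤ 1 := by
    have : v (2 : L) ≤ 1 := by
      rw [← one_add_one_eq_two]; exact (v.map_add _ _).trans (by simp)
    rw [show (4 : L) = 2 * 2 by norm_num, map_mul]
    exact mul_le_one' this this
  have hroot {α : L} (hα : α ∈ rootFinset L k b (n + 1)) : v α = 1 :=
    map_eq_one_of_iterVal hk hb ((mem_rootFinset hk0).1 hα)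
  set c := algebraMap K L (4 * k ^ 2 * b) with hc
  have hvc : v c ≤ 1 := by simpa only [hc, map_mul, map_pow, map_ofNat, hk, hb, one_pow, mul_one] using h4
  have hle {α : L} (hα : α ∈ rootFinset L k b (n + 1)) : v (α ^ 2 - c) ≤ 1 :=
    (v.map_sub _ _).trans (by simp [hroot hα, hvc])
  have hlc : v (algebraMap K L (numer k b (n + 1)).leadingCoeff) = 1 := by
    have := congrArg (fun x => v (algebraMap K L x)) (mul_leadingCoeff_numer b hk0 (n + 1))
    simpa [hk] using this
  have hprod : ∏ α ∈ rootFinset L k b (n + 1), v (α ^ 2 - c) = exp m ^ 2 := by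
    have := congrArg v (prod_discr hb0 hsep hsplit)
    simpa [hlc, hb, hdn, ← hc] using this
  obtain ⟨β, hβ, hβ1⟩ : ∃ β ∈ rootFinset L k b (n + 1), v (β ^ 2 - c) < 1 := by
    by_contra! H
    rw [Finset.prod_congr rfl fun α hα => (hle hα).antisymm (H α hα), Finset.prod_const_one,
      ← exp_nsmul, eq_comm, ← exp_zero, exp_inj] at hprod
    simp [hm] at hprod
  have hother : ∀ γ ∈ rootFinset L k b (n + 1), γ ^ 2 ≠ β ^ 2 → v (γ ^ 2 - c) = 1 := by
    intro γ hγ hne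
    refine (hle hγ).antisymm (not_lt.1 fun hlt => hne ?_)
    -- The difference of two discriminants is γ² - β², so two small ones would make γ congruent to β
    -- or -β.
    have h1 : v ((γ - β) * (γ - -β)) < 1 := by
      rw [show (γ - β) * (γ - -β) = (γ ^ 2 - c) - (β ^ 2 - c) by ring]
      exact v.map_sub_lt hlt hβ1
    have huniq {δ : L} (hδ : δ ∈ rootFinset L k b (n + 1)) (h : v (γ - δ) < 1) : γ = δ :=
      eq_of_iterVal_of_map_sub_lt_one hk hb hd ((mem_rootFinset hk0).1 hγ)
        ((mem_rootFinset hk0).1 hδ) h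
    have h2 : v (γ - β) < 1 ∨ v (γ - -β) < 1 := by
      by_contra! H
      exact h1.not_ge (by rw [map_mul]; exact one_le_mul H.1 H.2)
    rcases h2 with h2 | h2
    · rw [huniq hβ h2]
    · rw [huniq (neg_mem_rootFinset hk0 hβ) h2, neg_sq]
  refine ⟨β, hβ, ?_, hother⟩
  have hβ0 : β ≠ 0 := ne_zero_of_iterVal (by simpa) (by simpa) ((mem_rootFinset hk0).1 hβ)
  have hne : β ≠ -β := self_ne_neg.2 hβ0
  have hsub : {β, -β} ⊆ rootFinset L k b (n + 1) := by
    simp [Finset.insert_subset_iff, hβ, neg_mem_rootFinset hk0 hβ]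
  -- Only ±β contribute to the product, so it equals the square of the valuation sought.
  rw [← Finset.prod_subset hsub, Finset.prod_pair hne, neg_sq, ← sq] at hprod
  · exact (pow_left_inj₀ zero_le zero_le two_ne_zero).1 hprod
  · intro γ hγ hγ'
    refine hother γ hγ fun h => hγ' ?_
    simpa using sq_eq_sq_iff_eq_or_eq_neg.1 h

open WithZero in
/-- The discriminants are independent modulo squares. -/
theorem not_isSquare_prod_discr {K L : Type*} [Field K] [NumberField K] [Field L] [NumberField L]
    [Algebra K L] [IsGalois K L] {k b : K} {n : ℕ} (hirr : Irreducible (numer k b (n + 1)))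
    (𝔭 : HeightOneSpectrum (𝓞 K)) (hk : HasOrd 𝔭 k 0) (hb : HasOrd 𝔭 b 0)
    (hd : ∀ j, 1 ≤ j → j ≤ n + 1 → HasOrd 𝔭 (delta k j) 0) {m : ℤ} (hm : Odd m)
    (hdn : HasOrd 𝔭 (delta k (n + 2)) m)
    (hsplit : ((numer k b (n + 1)).map (algebraMap K L)).Splits)
    (hgen : IntermediateField.adjoin K (rootFinset L k b (n + 1) : Set L) = ⊤)
    {S : Finset L} (hS : S ⊆ discrFinset L k b (n + 1)) (hne : S.Nonempty) :
    ¬ IsSquare (∏ d ∈ S, d) := by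
  classical
  simp only [HasOrd, neg_zero, exp_zero] at hk hb hd hdn
  have hk0 : k ≠ 0 := by rintro rfl; simp at hk
  obtain ⟨𝔓, h𝔓⟩ := exists_heightOneSpectrum_liesOver L 𝔭
  set v := 𝔓.valuation L
  -- unit valuations lift before the extension is known to be unramified
  have hunit {x : K} (hx : 𝔭.valuation K x = 1) : v (algebraMap K L x) = 1 := by
    rw [← HeightOneSpectrum.valuation_liesOver L 𝔭 𝔓, hx, one_pow]
  have hvk := hunit hk
  have hvb := hunit hb
  have hvd (j) (h1 : 1 ≤ j) (h2 : j ≤ n + 1) :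
      v (iterVal (algebraMap K L k) 1 1 j).1 = 1 := by
    have := hunit (hd j h1 h2)
    rwa [algebraMap_delta, map_mul, hvk, one_mul] at this
  have hv (x : K) : v (algebraMap K L x) = 𝔭.valuation K x := by
    refine valuation_algebraMap_of_generators 𝔭 𝔓 hgen (fun x hx => ?_) (fun x hx σ h => ?_) x
    · exact (map_eq_one_of_iterVal hvk hvb ((mem_rootFinset hk0).1 hx)).le
    · exact eq_of_iterVal_of_map_sub_lt_one hvk hvb hvd
        ((mem_rootFinset hk0).1 (map_mem_rootFinset hk0 σ hx)) ((mem_rootFinset hk0).1 hx) h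
  have hvdn : v (iterVal (algebraMap K L k) 1 1 (n + 2)).1 = exp (-m) := by
    have := (hv _).trans hdn
    rwa [algebraMap_delta, map_mul, hvk, one_mul] at this
  obtain ⟨β, hβ, hβ1, hβ2⟩ := exists_valuation_discr v hvk hvb hvd
    (neg_ne_zero.2 fun h => by simp [h] at hm) hvdn hirr.separable hsplit
  obtain ⟨d₀, hd₀⟩ := hne
  obtain ⟨γ, hγ, rfl⟩ := mem_discrFinset.1 (hS hd₀)
  -- Irreducibility enters here: some conjugation takes a chosen factor to the discriminant of β.
  obtain ⟨σ, hσ⟩ : ∃ σ : Gal(L/K), σ γ = β := by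
    refine (IsConjRoot.exists_algEquiv ?_)
    rw [isConjRoot_def, ← minpoly.eq_of_irreducible hirr, ← minpoly.eq_of_irreducible hirr]
    · rw [aeval_numer]; exact (mem_rootFinset hk0).1 hγ
    · rw [aeval_numer]; exact (mem_rootFinset hk0).1 hβ
  rintro ⟨y, hy⟩
  have h := congrArg (fun x => v (σ x)) hy
  simp only [map_prod, map_mul] at h
  have hσd (α : L) : σ (α ^ 2 - algebraMap K L (4 * k ^ 2 * b)) =
      σ α ^ 2 - algebraMap K L (4 * k ^ 2 * b) := by
    rw [map_sub, map_pow, AlgEquiv.commutes]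
  -- All other conjugated factors are units, so the left side has odd order, while the right side is
  -- the valuation of a square.
  rw [Finset.prod_eq_single_of_mem _ hd₀, hσd, hσ, hβ1] at h
  · have h0 : v (σ y) ≠ 0 := by intro h0; rw [h0, zero_mul] at h; exact exp_ne_zero h
    rw [← exp_log h0, ← exp_add, exp_inj] at h
    rw [← Int.not_even_iff_odd] at hm
    exact hm (even_neg.1 ⟨_, h⟩)
  · intro d hd hne
    obtain ⟨α, hα, rfl⟩ := mem_discrFinset.1 (hS hd)
    rw [hσd]
    refine hβ2 _ (map_mem_rootFinset hk0 σ hα) fun h => hne ?_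
    rw [← hσ, ← map_pow, ← map_pow] at h
    rw [σ.injective h]

end Independence

/-! ### Kummer theory for square roots -/

section Kummer

/-- The sign character `ZMod 2 → {±1}`. -/
def signOf (R : Type*) [Ring R] (a : ZMod 2) : R := if a = 0 then 1 else -1

theorem signOf_add (R : Type*) [Ring R] (a c : ZMod 2) :
    signOf R (a + c) = signOf R a * signOf R c := by
  have h (x : ZMod 2) : x = 0 ∨ x = 1 := by revert x; decide
  rcases h a with rfl | rfl <;> rcases h c with rfl | rfl <;>
    simp [signOf, show (1 + 1 : ZMod 2) = 0 from rfl]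

theorem signOf_sum (R : Type*) [CommRing R] {ι : Type*} (s : Finset ι) (w : ι → ZMod 2) :
    signOf R (∑ i ∈ s, w i) = ∏ i ∈ s, signOf R (w i) := by
  classical
  induction s using Finset.induction_on with
  | empty => simp [signOf]
  | insert i s hi ih => rw [Finset.sum_insert hi, Finset.prod_insert hi, signOf_add, ih]

variable {K Ω : Type*} [Field K] [Field Ω] [Algebra K Ω]

/-- The sign vectors realized on a family of square roots by automorphisms over `L`. -/
def signSubmodule (L : IntermediateField K Ω) {ι : Type*} (r : ι → Ω) :
    Submodule (ZMod 2) (ι → ZMod 2) where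
  carrier := {w | ∃ σ ∈ L.fixingSubgroup, ∀ i, σ (r i) = signOf Ω (w i) * r i}
  zero_mem' := ⟨1, one_mem _, fun i => by simp [signOf]⟩
  add_mem' := by
    rintro w w' ⟨σ, hσ, h⟩ ⟨τ, hτ, h'⟩
    refine ⟨σ * τ, mul_mem hσ hτ, fun i => ?_⟩
    have hs : σ (signOf Ω (w' i)) = signOf Ω (w' i) := by
      unfold signOf; split_ifs <;> simp
    rw [AlgEquiv.mul_apply, h', map_mul, hs, h, Pi.add_apply, signOf_add]
    ring
  smul_mem' := by
    rintro c w ⟨σ, hσ, h⟩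
    obtain rfl | rfl : c = 0 ∨ c = 1 := by revert c; decide
    · exact ⟨1, one_mem _, fun i => by simp [signOf]⟩
    · exact ⟨σ, hσ, by simpa using h⟩

/-- By duality, a proper subspace of sign vectors lies in the kernel of a nonzero functional, which
over 𝔽₂ is summation over a nonempty set S. Then the product of the r i over S is Galois-fixed,
hence lies in L, and its square is the product of the d i. -/
theorem signSubmodule_eq_top [IsGalois K Ω] (L : IntermediateField K Ω) {ι : Type*} [Fintype ι]
    (d : ι → L) (hd : ∀ S : Finset ι, S.Nonempty → ¬ IsSquare (∏ i ∈ S, d i)) (r : ι → Ω)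
    (hr : ∀ i, r i ^ 2 = d i) : signSubmodule L r = ⊤ := by
  classical
  by_contra hne
  obtain ⟨f, hf0, hf⟩ := Submodule.exists_le_ker_of_lt_top _ (lt_top_iff_ne_top.2 hne)
  let S : Finset ι := {i | f (Pi.single i 1) ≠ 0}
  have hfS (w : ι → ZMod 2) : f w = ∑ i ∈ S, w i := by
    conv_lhs => rw [← Finset.univ_sum_single w, map_sum]
    rw [Finset.sum_filter]
    refine Finset.sum_congr rfl fun i _ => ?_
    have h1 : Pi.single i (w i) = w i • (Pi.single i 1 : ι → ZMod 2) := by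
      rw [← Pi.single_smul, smul_eq_mul, mul_one]
    rw [h1, map_smul, smul_eq_mul]
    generalize f (Pi.single i 1) = a
    generalize w i = c
    revert a c; decide
  have hS : S.Nonempty := by
    rw [Finset.nonempty_iff_ne_empty]
    rintro h
    exact hf0 (LinearMap.ext fun w => by rw [hfS, h]; simp)
  apply hd S hS
  have hmem : ∏ i ∈ S, r i ∈ L := by
    rw [← InfiniteGalois.fixedField_fixingSubgroup L, IntermediateField.mem_fixedField_iff]
    intro σ hσ
    have hval (i) : ∃ a : ZMod 2, σ (r i) = signOf Ω a * r i := by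
      have : σ (r i) ^ 2 = r i ^ 2 := by
        rw [← map_pow, hr]
        exact (IntermediateField.mem_fixingSubgroup_iff _ _).1 hσ _ (d i).2
      rcases sq_eq_sq_iff_eq_or_eq_neg.1 this with h | h
      · exact ⟨0, by simp [signOf, h]⟩
      · exact ⟨1, by simp [signOf, h]⟩
    choose w hw using hval
    have h0 : ∑ i ∈ S, w i = 0 := by
      rw [← hfS]; exact hf (show w ∈ signSubmodule L r from ⟨σ, hσ, hw⟩)
    rw [map_prod, Finset.prod_congr rfl fun i _ => hw i, Finset.prod_mul_distrib, ← signOf_sum, h0]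
    simp [signOf]
  refine ⟨⟨_, hmem⟩, Subtype.ext ?_⟩
  have : ((∏ i ∈ S, d i : L) : Ω) = ∏ i ∈ S, (d i : Ω) := map_prod (algebraMap L Ω) _ _
  rw [this, ← Finset.prod_congr rfl fun i _ => hr i, Finset.prod_pow, sq]
  rfl

/-- If the elements of `D` are independent modulo squares, every choice of signs of their square
roots is realized by an automorphism. -/
theorem exists_fixingSubgroup_signs [IsGalois K Ω] [NeZero (2 : Ω)] (L : IntermediateField K Ω)
    {D : Finset L} (hD : ∀ S ⊆ D, S.Nonempty → ¬ IsSquare (∏ d ∈ S, d)) {r : L → Ω}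
    (hr : ∀ d, r d ^ 2 = d) (T : Set L) :
    ∃ σ ∈ L.fixingSubgroup, ∀ d ∈ D, σ (r d) ≠ r d ↔ d ∈ T := by
  classical
  have htop := signSubmodule_eq_top L (fun d : D => (d : L)) (fun S hS => by
    have := hD (S.map ⟨_, Subtype.val_injective⟩) (fun x hx => by
      obtain ⟨y, -, rfl⟩ := Finset.mem_map.1 hx; exact y.2) (hS.map)
    rwa [Finset.prod_map] at this) (fun d => r d) (fun d => hr d)
  obtain ⟨σ, hσ, h⟩ := (htop ▸ Submodule.mem_top :
    (fun d : D => if (d : L) ∈ T then (1 : ZMod 2) else 0) ∈ signSubmodule L fun d : D => r d)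
  refine ⟨σ, hσ, fun d hd => ?_⟩
  -- A zero square root could not change sign; independence of the singleton {d} excludes it, as 0
  -- is a square.
  have hr0 : r d ≠ 0 := fun h0 => hD {d} (by simpa using hd) (by simp) (by
    have := hr d
    rw [h0, zero_pow two_ne_zero] at this
    rw [Finset.prod_singleton, show d = 0 from Subtype.ext this.symm]
    exact IsSquare.zero)
  have h1 := h ⟨d, hd⟩
  dsimp only at h1
  rw [h1]
  by_cases hT : d ∈ T
  · simp [signOf, hT, neg_eq_iff_add_eq_zero, ← two_mul, hr0, two_ne_zero]
  · simp [signOf, hT]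

end Kummer

/-! ### The fields K_n and the Galois action on the tree -/

section LevelField

variable {K : Type*} [Field K] {k b : K}

theorem phi_infty (k b : K) : phi k b OnePoint.infty = OnePoint.infty := rfl

theorem phi_zero (k b : K) : phi k b ((0 : AlgebraicClosure K) : OnePoint _) = OnePoint.infty := by
  simp [phi]

theorem phi_coe {x : AlgebraicClosure K} (hx : x ≠ 0) :
    phi k b (x : OnePoint (AlgebraicClosure K)) =
      ((algebraMap K (AlgebraicClosure K) k * (x ^ 2 + algebraMap K (AlgebraicClosure K) b) / x :
        AlgebraicClosure K) : OnePoint (AlgebraicClosure K)) := by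
  simp [phi, hx]

theorem infty_notMem_level (n : ℕ) : (OnePoint.infty : OnePoint (AlgebraicClosure K)) ∉ level k b n := by
  intro h
  rw [level, Set.mem_ofPred_eq, Function.iterate_fixed (phi_infty k b)] at h
  exact OnePoint.infty_ne_coe _ h

theorem mem_level_succ {n : ℕ} {x : OnePoint (AlgebraicClosure K)} :
    x ∈ level k b (n + 1) ↔ phi k b x ∈ level k b n := Iff.rfl

theorem coe_mem_level (hk : k ≠ 0) (hb : b ≠ 0) {n : ℕ} {x : AlgebraicClosure K} :
    (x : OnePoint (AlgebraicClosure K)) ∈ level k b n ↔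
      x ∈ rootFinset (AlgebraicClosure K) k b n := by
  rw [mem_rootFinset hk]
  induction n generalizing x with
  | zero => simp [level, iterVal]
  | succ n ih =>
    rw [mem_level_succ]
    rcases eq_or_ne x 0 with rfl | hx
    · rw [phi_zero]
      refine iff_of_false (infty_notMem_level n) fun h => ?_
      exact ne_zero_of_iterVal (by simpa) (by simpa) h rfl
    · rw [phi_coe hx, ih, iterVal_succ_eq_zero_iff hx]

theorem exists_of_mem_level (hk : k ≠ 0) (hb : b ≠ 0) {n : ℕ} {x : OnePoint (AlgebraicClosure K)}
    (hx : x ∈ level k b n) :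
    ∃ y ∈ rootFinset (AlgebraicClosure K) k b n, x = y := by
  induction x using OnePoint.rec with
  | infty => exact absurd hx (infty_notMem_level n)
  | coe y => exact ⟨y, (coe_mem_level hk hb).1 hx, rfl⟩

theorem levelField_eq (hk : k ≠ 0) (hb : b ≠ 0) (n : ℕ) :
    levelField k b n = IntermediateField.adjoin K ((numer k b n).rootSet (AlgebraicClosure K)) := by
  rw [levelField]
  congr 1
  ext x
  rw [Set.mem_ofPred_eq, coe_mem_level hk hb, mem_rootFinset hk, ← aeval_numer,
    mem_rootSet_of_ne (numer_ne_zero hk n)]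

theorem mem_levelField (hk : k ≠ 0) (hb : b ≠ 0) {n : ℕ} {x : AlgebraicClosure K}
    (hx : x ∈ rootFinset (AlgebraicClosure K) k b n) : x ∈ levelField k b n :=
  IntermediateField.subset_adjoin _ _ ((coe_mem_level hk hb).2 hx)

theorem isSplittingField_levelField (hk : k ≠ 0) (hb : b ≠ 0) (n : ℕ) :
    IsSplittingField K (levelField k b n) (numer k b n) := by
  rw [levelField_eq hk hb]
  exact IntermediateField.adjoin_rootSet_isSplittingField (IsAlgClosed.splits _)

theorem exists_phi_eq (hk : k ≠ 0) (hb : b ≠ 0) (α : AlgebraicClosure K) :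
    ∃ x ≠ 0, algebraMap K (AlgebraicClosure K) k *
      (x ^ 2 + algebraMap K (AlgebraicClosure K) b) / x = α := by
  have hk0 : algebraMap K (AlgebraicClosure K) k ≠ 0 := by simpa
  have hb0 : algebraMap K (AlgebraicClosure K) b ≠ 0 := by simpa
  obtain ⟨x, hx⟩ := IsAlgClosed.exists_root
    (C (algebraMap K (AlgebraicClosure K) k) * X ^ 2 + C (-α) * X +
      C (algebraMap K (AlgebraicClosure K) k * algebraMap K (AlgebraicClosure K) b) :
      Polynomial (AlgebraicClosure K))
    (by rw [degree_quadratic hk0]; decide)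
  simp only [IsRoot.def, eval_add, eval_mul, eval_C, eval_pow, eval_X] at hx
  have hx0 : x ≠ 0 := by
    rintro rfl
    simp [hk0, hb0] at hx
  exact ⟨x, hx0, by rw [div_eq_iff hx0]; linear_combination hx⟩

theorem levelField_le_succ (hk : k ≠ 0) (hb : b ≠ 0) (n : ℕ) :
    levelField k b n ≤ levelField k b (n + 1) := by
  rw [levelField, IntermediateField.adjoin_le_iff]
  intro α hα
  obtain ⟨x, hx0, rfl⟩ := exists_phi_eq hk hb α
  have hxmem : x ∈ levelField k b (n + 1) := by
    refine IntermediateField.subset_adjoin _ _ ?_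
    rw [Set.mem_ofPred_eq, mem_level_succ, phi_coe hx0]
    exact hα
  exact div_mem (mul_mem (algebraMap_mem _ _) (add_mem (pow_mem hxmem 2) (algebraMap_mem _ _))) hxmem

theorem levelField_mono (hk : k ≠ 0) (hb : b ≠ 0) : Monotone (levelField k b) :=
  monotone_nat_of_le_succ (levelField_le_succ hk hb)

theorem coe_galAction_apply (n : ℕ) (σ : Gal(AlgebraicClosure K/K)) (v : vertices k b n) :
    (((galAction k b n σ : Equiv.Perm (vertices k b n)) v : vertices k b n) :
      OnePoint (AlgebraicClosure K)) = OnePoint.map σ (v : OnePoint (AlgebraicClosure K)) := rfl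

theorem map_eq_self_of_mem_fixingSubgroup (hk : k ≠ 0) (hb : b ≠ 0) {n : ℕ}
    {σ : Gal(AlgebraicClosure K/K)} (hσ : σ ∈ (levelField k b n).fixingSubgroup)
    {x : OnePoint (AlgebraicClosure K)} (hx : x ∈ vertices k b n) : OnePoint.map σ x = x := by
  obtain ⟨i, hi, hx⟩ := hx
  obtain ⟨y, hy, rfl⟩ := exists_of_mem_level hk hb hx
  rw [OnePoint.map_some, (IntermediateField.mem_fixingSubgroup_iff _ _).1 hσ y
    (levelField_mono hk hb hi (mem_levelField hk hb hy))]

theorem ker_galAction (hk : k ≠ 0) (hb : b ≠ 0) (n : ℕ) :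
    (galAction k b n).ker = (levelField k b n).fixingSubgroup := by
  ext σ
  rw [MonoidHom.mem_ker]
  constructor
  · intro h
    refine mem_fixingSubgroup_adjoin fun x hx => ?_
    have h1 := coe_galAction_apply n σ ⟨(x : OnePoint (AlgebraicClosure K)), n, le_rfl, hx⟩
    rw [h] at h1
    exact (OnePoint.coe_injective h1).symm
  · intro h
    refine Subtype.ext (Equiv.ext fun v => Subtype.ext ?_)
    rw [coe_galAction_apply, map_eq_self_of_mem_fixingSubgroup hk hb h v.2]
    rfl

/-- The kernel of the action on T_{n+1} is the group fixing K_{n+1}, so the image of the group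
fixing K_n has order equal to the relative index, which is the relative degree. -/
theorem relfinrank_levelField [CharZero K] (hk : k ≠ 0) (hb : b ≠ 0) (n : ℕ) :
    IntermediateField.relfinrank (levelField k b n) (levelField k b (n + 1)) =
      Nat.card ((levelField k b n).fixingSubgroup.map (galAction k b (n + 1))) := by
  have : IsSplittingField K (levelField k b n) (numer k b n) :=
    isSplittingField_levelField hk hb n
  have : FiniteDimensional K (levelField k b n) :=
    IsSplittingField.finiteDimensional _ (numer k b n)
  have h1 := IntermediateField.finrank_bot_mul_relfinrank (levelField_le_succ hk hb n)
  rw [IntermediateField.finrank_eq_fixingSubgroup_index,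
    IntermediateField.finrank_eq_fixingSubgroup_index (L := levelField k b (n + 1)),
    ← Subgroup.relIndex_mul_index (IntermediateField.fixingSubgroup_le (levelField_le_succ hk hb n)),
    mul_comm, mul_left_inj', ← ker_galAction hk hb (n + 1), Subgroup.relIndex_ker] at h1
  · exact h1
  · rw [← IntermediateField.finrank_eq_fixingSubgroup_index]
    exact Module.finrank_pos.ne'

end LevelField

/-! ### Square roots of the discriminants -/

section Gap

variable {K : Type*} [Field K]

/-- `k` times the difference of the two preimages `x` and `b / x` of `φ(x)`; its square is the
discriminant of `k (X² + b) - φ(x) X`. -/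
noncomputable def gap (k b : K) (x : AlgebraicClosure K) : AlgebraicClosure K :=
  algebraMap K _ k * (x - algebraMap K _ b / x)

variable {k b : K}

theorem gap_sq {x : AlgebraicClosure K} (hx : x ≠ 0) :
    gap k b x ^ 2 = (algebraMap K (AlgebraicClosure K) k *
      (x ^ 2 + algebraMap K (AlgebraicClosure K) b) / x) ^ 2 -
        algebraMap K (AlgebraicClosure K) (4 * k ^ 2 * b) := by
  simp only [gap, map_mul, map_pow, map_ofNat]
  field_simp
  ring

/-- The squared gap is invariant under x ↦ -x and x ↦ b/x; as an equation in y it is a quartic whose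
four roots are the orbit of x. -/
theorem eq_of_gap_sq_eq (hk : k ≠ 0) {x y : AlgebraicClosure K} (hx : x ≠ 0) (hy : y ≠ 0)
    (h : gap k b x ^ 2 = gap k b y ^ 2) :
    (y = x ∨ y = -x) ∨
      (y = algebraMap K (AlgebraicClosure K) b / x ∨
        y = -(algebraMap K (AlgebraicClosure K) b / x)) := by
  have hk0 : algebraMap K (AlgebraicClosure K) k ≠ 0 := by simpa
  set B := algebraMap K (AlgebraicClosure K) b
  rw [gap, gap, mul_pow, mul_pow, mul_right_inj' (pow_ne_zero _ hk0)] at h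
  have h' : ((y - x) * (y - -x)) * ((y * x - B) * (y * x - -B)) = 0 := by
    field_simp at h
    linear_combination -h
  rw [eq_div_iff hx, ← neg_div, eq_div_iff hx]
  simpa only [mul_eq_zero, sub_eq_zero] using h'

/-- The gap equals 2kx - φ(x), so over the fixed point φ(x) it carries the same information as x. -/
theorem map_ne_iff_map_gap_ne [CharZero K] (hk : k ≠ 0) {x : AlgebraicClosure K} (hx : x ≠ 0)
    {σ : Gal(AlgebraicClosure K/K)}
    (hσ : σ (algebraMap K (AlgebraicClosure K) k *
      (x ^ 2 + algebraMap K (AlgebraicClosure K) b) / x) = algebraMap K (AlgebraicClosure K) k *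
      (x ^ 2 + algebraMap K (AlgebraicClosure K) b) / x) :
    σ x ≠ x ↔ σ (gap k b x) ≠ gap k b x := by
  have : CharZero (AlgebraicClosure K) := charZero_of_injective_algebraMap (algebraMap K _).injective
  have hk0 : algebraMap K (AlgebraicClosure K) k ≠ 0 := by simpa
  have e : gap k b x = 2 * algebraMap K (AlgebraicClosure K) k * x -
      algebraMap K (AlgebraicClosure K) k *
        (x ^ 2 + algebraMap K (AlgebraicClosure K) b) / x := by
    rw [gap]; field_simp; ring
  rw [e, map_sub, hσ, map_mul, map_mul, map_ofNat, AlgEquiv.commutes, Ne, Ne, sub_left_inj,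
    mul_right_inj' (mul_ne_zero two_ne_zero hk0)]

end Gap

/-! ### Elements of C_{n+1} trivial on T_n -/

section Kernel

variable {K : Type*} [Field K] {k b : K} {n : ℕ}

theorem phi_mem_rootFinset (hk : k ≠ 0) (hb : b ≠ 0) {x : AlgebraicClosure K}
    (hx : x ∈ rootFinset (AlgebraicClosure K) k b (n + 1)) : x ≠ 0 ∧
      algebraMap K (AlgebraicClosure K) k *
        (x ^ 2 + algebraMap K (AlgebraicClosure K) b) / x ∈
          rootFinset (AlgebraicClosure K) k b n := by
  rw [mem_rootFinset hk] at hx ⊢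
  have hx0 : x ≠ 0 := ne_zero_of_iterVal (by simpa) (by simpa) hx
  exact ⟨hx0, (iterVal_succ_eq_zero_iff hx0 n).1 hx⟩

theorem div_mem_rootFinset (hk : k ≠ 0) (hb : b ≠ 0) {x : AlgebraicClosure K}
    (hx : x ∈ rootFinset (AlgebraicClosure K) k b (n + 1)) :
    algebraMap K (AlgebraicClosure K) b / x ∈ rootFinset (AlgebraicClosure K) k b (n + 1) := by
  have hx0 := (phi_mem_rootFinset hk hb hx).1
  have hb0 : algebraMap K (AlgebraicClosure K) b ≠ 0 := by simpa
  rw [mem_rootFinset hk] at hx ⊢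
  rw [iterVal_succ_eq_zero_iff hx0] at hx
  rw [iterVal_succ_eq_zero_iff (div_ne_zero hb0 hx0), ← hx]
  congr 2
  field_simp
  ring

theorem coe_mem_vertices (hk : k ≠ 0) (hb : b ≠ 0) {x : AlgebraicClosure K}
    (hx : x ∈ rootFinset (AlgebraicClosure K) k b n) :
    (x : OnePoint (AlgebraicClosure K)) ∈ vertices k b n :=
  ⟨n, le_rfl, (coe_mem_level hk hb).2 hx⟩

/-- The tree automorphism `τ` moves the vertex `x`. -/
def Moves (τ : treeAut k b n) (x : AlgebraicClosure K) : Prop :=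
  ∃ h : (x : OnePoint (AlgebraicClosure K)) ∈ vertices k b n,
    (((τ : Equiv.Perm (vertices k b n)) ⟨x, h⟩ : vertices k b n) : OnePoint (AlgebraicClosure K)) ≠ x

theorem centralizerKer_fixes {τ : treeAut k b (n + 1)}
    (hτ : τ ∈ centralizerKer k b (n + 1) n) {v : vertices k b (n + 1)}
    (hv : (v : OnePoint (AlgebraicClosure K)) ∈ vertices k b n) :
    (τ : Equiv.Perm (vertices k b (n + 1))) v = v :=
  (mem_fixingSubgroup_iff _).1 hτ.2 v hv

/-- The automorphism fixes φ(x), so the image of x stays in the fibre {x, b/x}. -/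
theorem centralizerKer_apply (hk : k ≠ 0) (hb : b ≠ 0) {τ : treeAut k b (n + 1)}
    (hτ : τ ∈ centralizerKer k b (n + 1) n) {x : AlgebraicClosure K}
    (hx : x ∈ rootFinset (AlgebraicClosure K) k b (n + 1)) :
    (((τ : Equiv.Perm (vertices k b (n + 1))) ⟨x, coe_mem_vertices hk hb hx⟩ :
        vertices k b (n + 1)) : OnePoint (AlgebraicClosure K)) = x ∨
    (((τ : Equiv.Perm (vertices k b (n + 1))) ⟨x, coe_mem_vertices hk hb hx⟩ :
        vertices k b (n + 1)) : OnePoint (AlgebraicClosure K)) =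
      (algebraMap K (AlgebraicClosure K) b / x : AlgebraicClosure K) := by
  obtain ⟨hx0, hφ⟩ := phi_mem_rootFinset hk hb hx
  have hk0 : algebraMap K (AlgebraicClosure K) k ≠ 0 := by simpa
  set w := (τ : Equiv.Perm (vertices k b (n + 1))) ⟨x, coe_mem_vertices hk hb hx⟩ with hw
  set g := algebraMap K (AlgebraicClosure K) k *
        (x ^ 2 + algebraMap K (AlgebraicClosure K) b) / x with hg
  have hgn := coe_mem_vertices hk hb hφ
  let u : vertices k b (n + 1) := ⟨g, by
    obtain ⟨i, hi, h⟩ := hgn; exact ⟨i, hi.trans n.le_succ, h⟩⟩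
  have h1 : phi k b w = g := by
    have := (τ.2.2 ⟨x, coe_mem_vertices hk hb hx⟩ u).1 (phi_coe hx0)
    rwa [centralizerKer_fixes hτ (v := u) hgn] at this
  clear_value w
  obtain ⟨w, hwm⟩ := w
  dsimp only at h1 ⊢
  induction w using OnePoint.rec with
  | infty => exact absurd h1 (OnePoint.infty_ne_coe _)
  | coe y =>
    rcases eq_or_ne y 0 with rfl | hy0
    · rw [phi_zero] at h1; exact absurd h1 (OnePoint.infty_ne_coe _)
    rw [phi_coe hy0, OnePoint.coe_eq_coe, hg, div_eq_div_iff hy0 hx0] at h1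
    have h2 : algebraMap K (AlgebraicClosure K) k *
        ((y - x) * (y * x - algebraMap K (AlgebraicClosure K) b)) = 0 := by
      linear_combination h1
    simp only [mul_eq_zero, hk0, false_or, sub_eq_zero] at h2
    rw [OnePoint.coe_eq_coe, OnePoint.coe_eq_coe, eq_div_iff hx0]
    exact h2

theorem Moves.neg {τ : treeAut k b (n + 1)} (hτ : τ ∈ centralizerKer k b (n + 1) n)
    {x : AlgebraicClosure K} (h : Moves τ x) : Moves τ (-x) := by
  obtain ⟨hx, h⟩ := h
  let w : vertices k b (n + 1) := ⟨x, hx⟩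
  have hc : (τ : Equiv.Perm (vertices k b (n + 1))) ((iota k b (n + 1)).1 w) =
      (iota k b (n + 1)).1 ((τ : Equiv.Perm (vertices k b (n + 1))) w) := by
    have := Subgroup.mem_centralizer_singleton_iff.1 hτ.1
    exact congrArg (fun ρ : treeAut k b (n + 1) => ρ.1 w) this
  refine ⟨((iota k b (n + 1)).1 w).2, fun h' => h ?_⟩
  have h2 : (τ : Equiv.Perm (vertices k b (n + 1))) ((iota k b (n + 1)).1 w) =
      (iota k b (n + 1)).1 w := Subtype.ext h'
  rw [h2] at hc
  exact congrArg Subtype.val ((iota k b (n + 1)).1.injective hc).symm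

theorem Moves.div (hk : k ≠ 0) (hb : b ≠ 0) {τ : treeAut k b (n + 1)}
    (hτ : τ ∈ centralizerKer k b (n + 1) n) {x : AlgebraicClosure K}
    (hx : x ∈ rootFinset (AlgebraicClosure K) k b (n + 1)) (h : Moves τ x) :
    Moves τ (algebraMap K (AlgebraicClosure K) b / x) := by
  obtain ⟨hxm, h⟩ := h
  refine ⟨coe_mem_vertices hk hb (div_mem_rootFinset hk hb hx), fun h' => h ?_⟩
  have h1 := (centralizerKer_apply hk hb hτ hx).resolve_left h
  have h2 := τ.1.injective (Subtype.ext (h1.trans h'.symm))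
  exact h1.trans (congrArg Subtype.val h2).symm

/-- Whether a vertex moves depends only on its discriminant: x and b/x move together by injectivity,
x and -x by commutation with ι. This is the constraint that the centralizer imposes. -/
theorem Moves.of_gap_sq_eq (hk : k ≠ 0) (hb : b ≠ 0) {τ : treeAut k b (n + 1)}
    (hτ : τ ∈ centralizerKer k b (n + 1) n) {x y : AlgebraicClosure K}
    (hx : x ∈ rootFinset (AlgebraicClosure K) k b (n + 1))
    (hy : y ∈ rootFinset (AlgebraicClosure K) k b (n + 1)) (h : Moves τ x)
    (hxy : gap k b x ^ 2 = gap k b y ^ 2) : Moves τ y := by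
  rcases eq_of_gap_sq_eq hk (phi_mem_rootFinset hk hb hx).1 (phi_mem_rootFinset hk hb hy).1 hxy with
    (rfl | rfl) | rfl | rfl
  exacts [h, h.neg hτ, h.div hk hb hτ hx, (h.div hk hb hτ hx).neg hτ]

/-- The set of discriminants over which `τ` exchanges the two preimages. -/
def movedDiscr (τ : treeAut k b n) : Set (AlgebraicClosure K) :=
  {d | ∃ x ∈ rootFinset (AlgebraicClosure K) k b n, gap k b x ^ 2 = d ∧ Moves τ x}

theorem moves_iff (hk : k ≠ 0) (hb : b ≠ 0) {τ : treeAut k b (n + 1)}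
    (hτ : τ ∈ centralizerKer k b (n + 1) n) {x : AlgebraicClosure K}
    (hx : x ∈ rootFinset (AlgebraicClosure K) k b (n + 1)) :
    Moves τ x ↔ gap k b x ^ 2 ∈ movedDiscr τ :=
  ⟨fun h => ⟨x, hx, rfl, h⟩, fun ⟨_, hy, hxy, h⟩ => h.of_gap_sq_eq hk hb hτ hy hx hxy⟩

theorem eq_of_movedDiscr_eq (hk : k ≠ 0) (hb : b ≠ 0) {τ τ' : treeAut k b (n + 1)}
    (hτ : τ ∈ centralizerKer k b (n + 1) n) (hτ' : τ' ∈ centralizerKer k b (n + 1) n)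
    (h : movedDiscr τ = movedDiscr τ') : τ = τ' := by
  refine Subtype.ext (Equiv.ext ?_)
  rintro ⟨w, i, hi, hw⟩
  rcases Nat.le_succ_iff.1 hi with hi' | rfl
  · rw [centralizerKer_fixes hτ ⟨i, hi', hw⟩, centralizerKer_fixes hτ' ⟨i, hi', hw⟩]
  · obtain ⟨x, hx, rfl⟩ := exists_of_mem_level hk hb hw
    have hm : Moves τ x ↔ Moves τ' x := by rw [moves_iff hk hb hτ hx, moves_iff hk hb hτ' hx, h]
    refine Subtype.ext ?_
    by_cases hmx : Moves τ x
    · obtain ⟨_, h2⟩ := hm.1 hmx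
      obtain ⟨_, h1⟩ := hmx
      exact ((centralizerKer_apply hk hb hτ hx).resolve_left h1).trans
        ((centralizerKer_apply hk hb hτ' hx).resolve_left h2).symm
    · have h1 := not_exists.1 hmx (coe_mem_vertices hk hb hx)
      have h2 := not_exists.1 (mt hm.2 hmx) (coe_mem_vertices hk hb hx)
      exact (not_not.1 h1).trans (not_not.1 h2).symm

theorem galAction_mem_centralizerKer (hk : k ≠ 0) (hb : b ≠ 0)
    {σ : Gal(AlgebraicClosure K/K)} (hσ : σ ∈ (levelField k b n).fixingSubgroup) :
    galAction k b (n + 1) σ ∈ centralizerKer k b (n + 1) n := by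
  refine ⟨Subgroup.mem_centralizer_singleton_iff.2 ?_, (mem_fixingSubgroup_iff _).2 ?_⟩
  · refine Subtype.ext (Equiv.ext fun w => Subtype.ext ?_)
    change OnePoint.map σ (OnePoint.map (fun x => -x) (w : OnePoint (AlgebraicClosure K))) =
      OnePoint.map (fun x => -x) (OnePoint.map σ (w : OnePoint (AlgebraicClosure K)))
    generalize (w : OnePoint (AlgebraicClosure K)) = w
    induction w using OnePoint.rec with
    | infty => rfl
    | coe x => simp only [OnePoint.map_some, map_neg]
  · exact fun v hv => Subtype.ext (map_eq_self_of_mem_fixingSubgroup hk hb hσ hv)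

theorem moves_galAction (hk : k ≠ 0) (hb : b ≠ 0) (σ : Gal(AlgebraicClosure K/K))
    {x : AlgebraicClosure K} (hx : x ∈ rootFinset (AlgebraicClosure K) k b n) :
    Moves (galAction k b n σ) x ↔ σ x ≠ x := by
  constructor
  · rintro ⟨hx, h⟩ h'
    exact h (congrArg _ h')
  · exact fun h => ⟨coe_mem_vertices hk hb hx, fun h' => h (OnePoint.coe_injective h')⟩

end Kernel

/-! ### The Galois image and the order of the kernel -/

section Main

variable {K : Type*} [Field K] {k b : K}

theorem coe_mem_rootFinset_iff (hk : k ≠ 0) {n : ℕ} {L : IntermediateField K (AlgebraicClosure K)}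
    {x : L} :
    (x : AlgebraicClosure K) ∈ rootFinset (AlgebraicClosure K) k b n ↔ x ∈ rootFinset L k b n := by
  rw [mem_rootFinset hk, mem_rootFinset hk]
  have h := congrArg Prod.fst
    (iterVal_map (algebraMap L (AlgebraicClosure K)) (algebraMap K L k) (algebraMap K L b) x n)
  simp only [← IsScalarTower.algebraMap_apply] at h
  rw [show (x : AlgebraicClosure K) = algebraMap L _ x from rfl, h]
  simp

theorem exists_movedDiscr_galAction [CharZero K] (hk : k ≠ 0) (hb : b ≠ 0) {n : ℕ}
    (hD : ∀ S ⊆ discrFinset (levelField k b n) k b n, S.Nonempty → ¬ IsSquare (∏ d ∈ S, d))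
    (T : Set (AlgebraicClosure K)) :
    ∃ σ ∈ (levelField k b n).fixingSubgroup,
      ∀ x ∈ rootFinset (AlgebraicClosure K) k b (n + 1), σ x ≠ x ↔ gap k b x ^ 2 ∈ T := by
  have : CharZero (AlgebraicClosure K) := charZero_of_injective_algebraMap (algebraMap K _).injective
  choose r hr using fun d : levelField k b n =>
    IsAlgClosed.exists_pow_nat_eq (d : AlgebraicClosure K) two_pos
  obtain ⟨σ, hσ, h⟩ := exists_fixingSubgroup_signs _ hD hr {d | (d : AlgebraicClosure K) ∈ T}
  refine ⟨σ, hσ, fun x hx => ?_⟩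
  obtain ⟨hx0, hφ⟩ := phi_mem_rootFinset hk hb hx
  let g : levelField k b n := ⟨_, mem_levelField hk hb hφ⟩
  let d := g ^ 2 - algebraMap K (levelField k b n) (4 * k ^ 2 * b)
  have hd : d ∈ discrFinset (levelField k b n) k b n :=
    mem_discrFinset.2 ⟨g, (coe_mem_rootFinset_iff hk).1 hφ, rfl⟩
  have hgap : gap k b x ^ 2 = d := gap_sq hx0
  rw [map_ne_iff_map_gap_ne hk hx0 ((IntermediateField.mem_fixingSubgroup_iff _ _).1 hσ _ g.2)]
  rw [hgap]
  refine Iff.trans ?_ (h d hd)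
  rw [← hr d] at hgap
  rcases sq_eq_sq_iff_eq_or_eq_neg.1 hgap with e | e <;> simp [e]

theorem exists_galAction_eq [CharZero K] (hk : k ≠ 0) (hb : b ≠ 0) {n : ℕ}
    (hD : ∀ S ⊆ discrFinset (levelField k b n) k b n, S.Nonempty → ¬ IsSquare (∏ d ∈ S, d))
    {τ : treeAut k b (n + 1)} (hτ : τ ∈ centralizerKer k b (n + 1) n) :
    ∃ σ ∈ (levelField k b n).fixingSubgroup, galAction k b (n + 1) σ = τ := by
  obtain ⟨σ, hσ, h⟩ := exists_movedDiscr_galAction hk hb hD (movedDiscr τ)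
  refine ⟨σ, hσ, eq_of_movedDiscr_eq hk hb (galAction_mem_centralizerKer hk hb hσ) hτ ?_⟩
  ext d
  constructor
  · rintro ⟨x, hx, rfl, hm⟩
    exact (h x hx).1 ((moves_galAction hk hb σ hx).1 hm)
  · rintro ⟨x, hx, rfl, hm⟩
    exact ⟨x, hx, rfl, (moves_galAction hk hb σ hx).2
      ((h x hx).2 ((moves_iff hk hb hτ hx).1 hm))⟩

theorem map_fixingSubgroup_eq_centralizerKer [CharZero K] (hk : k ≠ 0) (hb : b ≠ 0) {n : ℕ}
    (hD : ∀ S ⊆ discrFinset (levelField k b n) k b n, S.Nonempty → ¬ IsSquare (∏ d ∈ S, d)) :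
    (levelField k b n).fixingSubgroup.map (galAction k b (n + 1)) =
      centralizerKer k b (n + 1) n := by
  refine le_antisymm ?_ fun τ hτ => exists_galAction_eq hk hb hD hτ
  rintro _ ⟨σ, hσ, rfl⟩
  exact galAction_mem_centralizerKer hk hb hσ

theorem exists_gap_sq_eq (hk : k ≠ 0) (hb : b ≠ 0) {n : ℕ} {d : levelField k b n}
    (hd : d ∈ discrFinset (levelField k b n) k b n) :
    ∃ x ∈ rootFinset (AlgebraicClosure K) k b (n + 1), gap k b x ^ 2 = d := by
  obtain ⟨α, hα, rfl⟩ := mem_discrFinset.1 hd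
  obtain ⟨x, hx0, hx⟩ := exists_phi_eq hk hb (α : AlgebraicClosure K)
  refine ⟨x, ?_, by rw [gap_sq hx0, hx]; rfl⟩
  rw [mem_rootFinset hk, iterVal_succ_eq_zero_iff hx0, hx, ← mem_rootFinset hk]
  exact (coe_mem_rootFinset_iff hk).2 hα

/-- The kernel is in bijection with the sets of discriminants: `movedDiscr` is injective on it, and
each set is attained by a Galois element. -/
theorem card_centralizerKer [CharZero K] (hk : k ≠ 0) (hb : b ≠ 0) {n : ℕ}
    (hD : ∀ S ⊆ discrFinset (levelField k b n) k b n, S.Nonempty → ¬ IsSquare (∏ d ∈ S, d)) :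
    Nat.card (centralizerKer k b (n + 1) n) = 2 ^ (discrFinset (levelField k b n) k b n).card := by
  classical
  let D := discrFinset (levelField k b n) k b n
  let f : centralizerKer k b (n + 1) n → Set D := fun τ =>
    {d | ((d : levelField k b n) : AlgebraicClosure K) ∈ movedDiscr (τ : treeAut k b (n + 1))}
  have hdiscr (x) (hx : x ∈ rootFinset (AlgebraicClosure K) k b (n + 1)) :
      ∃ d : D, ((d : levelField k b n) : AlgebraicClosure K) = gap k b x ^ 2 := by
    obtain ⟨hx0, hφ⟩ := phi_mem_rootFinset hk hb hx
    exact ⟨⟨⟨_, mem_levelField hk hb hφ⟩ ^ 2 - algebraMap K _ (4 * k ^ 2 * b),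
      mem_discrFinset.2 ⟨_, (coe_mem_rootFinset_iff hk).1 hφ, rfl⟩⟩, (gap_sq hx0).symm⟩
  have hf : Function.Bijective f := by
    constructor
    · rintro ⟨τ, hτ⟩ ⟨τ', hτ'⟩ h
      refine Subtype.ext (eq_of_movedDiscr_eq hk hb hτ hτ' ?_)
      ext d
      constructor <;> rintro ⟨x, hx, rfl, hm⟩ <;> obtain ⟨d, hd⟩ := hdiscr x hx <;>
        rw [← hd] <;> have h' := Set.ext_iff.1 h d
      · exact h'.1 (by change _ ∈ movedDiscr τ; rw [hd]; exact ⟨x, hx, rfl, hm⟩)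
      · exact h'.2 (by change _ ∈ movedDiscr τ'; rw [hd]; exact ⟨x, hx, rfl, hm⟩)
    · intro T
      obtain ⟨σ, hσ, h⟩ := exists_movedDiscr_galAction hk hb hD
        ((fun d : D => ((d : levelField k b n) : AlgebraicClosure K)) '' T)
      refine ⟨⟨_, galAction_mem_centralizerKer hk hb hσ⟩, Set.ext fun d => ?_⟩
      have hinj : Function.Injective (fun d : D => ((d : levelField k b n) : AlgebraicClosure K)) :=
        Subtype.val_injective.comp Subtype.val_injective
      rw [← hinj.mem_set_image (s := T)]
      constructor
      · rintro ⟨x, hx, hxd, hm⟩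
        have := (h x hx).1 ((moves_galAction hk hb σ hx).1 hm)
        rwa [hxd] at this
      · intro hd
        obtain ⟨x, hx, hxd⟩ := exists_gap_sq_eq hk hb d.2
        exact ⟨x, hx, hxd, (moves_galAction hk hb σ hx).2 ((h x hx).2 (hxd ▸ hd))⟩
  rw [Nat.card_eq_of_bijective f hf, Nat.card_eq_fintype_card, Fintype.card_set, Fintype.card_coe]

end Main

end ArborealQuadratic

theorem mainTheorem9 {K : Type*} [Field K] [NumberField K] (k b : K) (hk : k ≠ 0) (hb : b ≠ 0)
    (n : ℕ) (hn : 3 ≤ n) (hirr : Irreducible (ArborealQuadratic.numer k b (n - 1)))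
    (𝔭 : HeightOneSpectrum (𝓞 K))
    (hodd : ∃ m : ℤ, Odd m ∧ ArborealQuadratic.HasOrd 𝔭 (ArborealQuadratic.delta k n) m)
    (hdelta : ∀ j : ℕ, 1 ≤ j → j < n →
      ArborealQuadratic.HasOrd 𝔭 (ArborealQuadratic.delta k j) 0)
    (hvk : ArborealQuadratic.HasOrd 𝔭 k 0) (hvb : ArborealQuadratic.HasOrd 𝔭 b 0)
    (hv2 : ArborealQuadratic.HasOrd 𝔭 (2 : K) 0) :
    ArborealQuadratic.levelField k b (n - 1) ≤ ArborealQuadratic.levelField k b n ∧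
    IntermediateField.relfinrank (ArborealQuadratic.levelField k b (n - 1))
      (ArborealQuadratic.levelField k b n) = 2 ^ 2 ^ (n - 2) ∧
    Nat.card (ArborealQuadratic.centralizerKer k b n (n - 1)) = 2 ^ 2 ^ (n - 2) ∧
    (ArborealQuadratic.levelField k b (n - 1)).fixingSubgroup.map
      (ArborealQuadratic.galAction k b n) = ArborealQuadratic.centralizerKer k b n (n - 1) := by
  -- The roots of p_{m+1} give 2^m discriminants, and m = n - 2.
  obtain ⟨m, rfl⟩ : ∃ m, n = m + 2 := ⟨n - 2, by omega⟩
  obtain ⟨e, he, hdn⟩ := hodd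
  simp only [Nat.add_sub_cancel, show m + 2 - 1 = m + 1 from rfl] at hirr ⊢
  set L := ArborealQuadratic.levelField k b (m + 1) with hL
  have hspl : IsSplittingField K L (ArborealQuadratic.numer k b (m + 1)) :=
    ArborealQuadratic.isSplittingField_levelField hk hb (m + 1)
  have : FiniteDimensional K L :=
    IsSplittingField.finiteDimensional _ (ArborealQuadratic.numer k b (m + 1))
  have : NumberField L := NumberField.of_module_finite K L
  have : IsGalois K L := IsGalois.of_separable_splitting_field hirr.separable
  have hgen : IntermediateField.adjoin K
      (ArborealQuadratic.rootFinset L k b (m + 1) : Set L) = ⊤ := by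
    rw [← (isSplittingField_iff_intermediateField.1 hspl).2]
    congr 1
  have hD : ∀ S ⊆ ArborealQuadratic.discrFinset L k b (m + 1), S.Nonempty →
      ¬ IsSquare (∏ d ∈ S, d) := fun S hS hne =>
    ArborealQuadratic.not_isSquare_prod_discr hirr 𝔭 hvk hvb
      (fun j h1 h2 => hdelta j h1 (by omega)) he hdn hspl.splits hgen hS hne
  have hcard := ArborealQuadratic.card_centralizerKer hk hb hD
  rw [ArborealQuadratic.card_discrFinset hk hb hirr.separable hspl.splits] at hcard
  have hmap := ArborealQuadratic.map_fixingSubgroup_eq_centralizerKer hk hb hD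
  refine ⟨ArborealQuadratic.levelField_le_succ hk hb (m + 1), ?_, hcard, hmap⟩
  rw [hL, ArborealQuadratic.relfinrank_levelField hk hb (m + 1), ← hL, hmap, hcard]
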